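/- Let $K\in\mathbb{C}$ and let $n\ge 4$ be an integer. For complex numbers put \[H^K(a,b,c)=-a^2-b^2-c^2+2ab+2ac+2bc-Kabc,\qquad M(a,b,c,d,e,f)=\det\begin{bmatrix}\frac K2&1&1&1&1\\1&0&b&e&a\\1&b&0&c&f\\1&e&c&0&d\\1&a&f&d&0\end{bmatrix}.\] A \emph{spherical Heronian diamond} is a tuple $(a,b,c,d,e,f,p,q,r,s)\in\mathbb{C}^{10}$ such that $p^2=H^K(b,c,e)$, $q^2=H^K(a,d,e)$, $r^2=H^K(a,b,f)$, $s^2=H^K(c,d,f)$, $p+q=r+s+\frac K2(ap+bq-er)$, $4ef\left(1-\frac{Ke}4\right)=(p+q)^2+(a-b+c-d)^2-Ke(a-b)(c-d)$ and $e(r-s)=p(a-d)+q(b-c)$. A \emph{spherical Cayley-Menger diamond} is a tuple $(a,b,c,d,e,f)\in\mathbb{C}^6$ with $M(a,b,c,d,e,f)=0$. Let $I_n^{SCM}$ consist of the nodes $(i,j)\in\mathbb{Z}^2$ with $0\le j-i\le n$ and of the symbols $(i+\frac12,\diagup)$ and $(\diagdown,j+\frac12)$ for $i,j\in\mathbb{Z}$.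 Let $I_n$ consist of $I_n^{SCM}$ and of all points $(x,y)=(i+\frac12,j)$ and $(x,y)=(i,j+\frac12)$, with $i,j\in\mathbb{Z}$, such that $0\le y-x\le n$. A \emph{spherical Heronian frieze of order $n$} is an array $(z_\alpha)_{\alpha\in I_n}$ of complex numbers such that, for all integers $i,j$ with $1\le j-i\le n-1$, the tuple \[\bigl(z_{(i,j+1)},z_{(i+\frac12,\diagup)},z_{(i+1,j)},z_{(\diagdown,j+\frac12)},z_{(i,j)},z_{(i+1,j+1)},z_{(i+\frac12,j)},z_{(i,j+\frac12)},z_{(i+\frac12,j+1)},z_{(i+1,j+\frac12)}\bigr)\] is a spherical Heronian diamond, and such that $z_{(i,i)}=z_{(i,i+n)}=z_{(i,i+\frac12)}=z_{(i+\frac12,i+1)}=z_{(i,i+n-\frac12)}=z_{(i+\frac12,i+n)}=0$ for all $i\in\mathbb{Z}$. A \emph{spherical Cayley-Menger frieze of order $n$} is an array $\widehat{\mathbf z}=(z_\alpha)_{\alpha\in I_n^{SCM}}$ of complex numbers such that, for all integers $i,j$ with $1\le j-i\le n-1$, the tuple \[D_{i,j}(\widehat{\mathbf z})=\bigl(z_{(i,j+1)},z_{(i+\frac12,\diagup)},z_{(i+1,j)},z_{(\diagdown,j+\frac12)},z_{(i,j)},z_{(i+1,j+1)}\bigr)\]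 is a spherical Cayley-Menger diamond, and such that for all $i\in\mathbb{Z}$ one has $z_{(i,i)}=z_{(i,i+n)}=0$, $z_{(i,i+1)}=z_{(i+\frac12,\diagup)}=z_{(\diagdown,i+\frac12)}$ and $z_{(i,i+n-1)}=z_{(i-\frac12,\diagup)}=z_{(\diagdown,i+n-\frac12)}$. It is \emph{coherent} if for all integers $i,j$ with $2\le j-i\le n-2$ \[\frac{\partial M}{\partial e}(D_{i-1,j-1}(\widehat{\mathbf z}))\,\frac{\partial M}{\partial f}(D_{i,j}(\widehat{\mathbf z}))=\frac{\partial M}{\partial a}(D_{i-1,j}(\widehat{\mathbf z}))\,\frac{\partial M}{\partial c}(D_{i,j-1}(\widehat{\mathbf z})).\] Consider for an array the condition \[(*)\qquad z_{(i,j)}\notin\left\{0,\tfrac4K\right\}\quad\text{for all integers } i,j \text{ with } 2\le j-i\le n-2,\] where for $K=0$ only $z_{(i,j)}\ne0$ is required. \textbf{Theorem.} (1) Let $\mathbf z=(z_\alpha)_{\alpha\in I_n}$ be a spherical Heronian frieze satisfying $(*)$. Then the restriction of $\mathbf z$ to $I_n^{SCM}$ is a coherent spherical Cayley-Menger frieze.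 (2) Conversely, let $\widehat{\mathbf z}=(z_\alpha)_{\alpha\in I_n^{SCM}}$ be a coherent spherical Cayley-Menger frieze satisfying $(*)$, and suppose that for all integers $i,j$ with $2\le j-i\le n-1$ \[H^K\bigl(z_{(i,j)},z_{(i+1,j)},z_{(i+\frac12,\diagup)}\bigr)\ne0,\qquad H^K\bigl(z_{(i,j-1)},z_{(i,j)},z_{(\diagdown,j-\frac12)}\bigr)\ne0.\] Then there is a spherical Heronian frieze $\mathbf z=(z_\alpha)_{\alpha\in I_n}$ extending $\widehat{\mathbf z}$. It is unique up to a global change of sign of the entries indexed by $I_n\setminus I_n^{SCM}$; that is, the spherical Heronian friezes extending $\widehat{\mathbf z}$ are exactly $\mathbf z$ and the array obtained from $\mathbf z$ by this sign change. -/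

import Mathlib

noncomputable section

namespace SphericalFrieze

/-- The Heron polynomial `H^K(a, b, c)`. -/
def heronPoly (K a b c : ℂ) : ℂ :=
  -a ^ 2 - b ^ 2 - c ^ 2 + 2 * a * b + 2 * a * c + 2 * b * c - K * a * b * c

/-- Six numbers arranged in a diamond: `a` (top), `c` (bottom), `e` (left), `f` (right), and the
labels `b`, `d` of the two lines crossing the diamond. For a quadrilateral `A₁A₂A₃A₄` one has
`a = x₁₄`, `b = x₁₂`, `c = x₂₃`, `d = x₃₄`, `e = x₁₃`, `f = x₂₄`. -/
structure SixTuple where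
  a : ℂ
  b : ℂ
  c : ℂ
  d : ℂ
  e : ℂ
  f : ℂ

/-- Six numbers as above together with the numbers `p, q, r, s` at the midpoints of the
lower left, upper left, upper right and lower right sides of the diamond. -/
structure TenTuple extends SixTuple where
  p : ℂ
  q : ℂ
  r : ℂ
  s : ℂ

/-- The ten numbers form a spherical Heronian diamond. -/
structure IsHeronianDiamond (K : ℂ) (x : TenTuple) : Prop where
  heron_p : x.p ^ 2 = heronPoly K x.b x.c x.e
  heron_q : x.q ^ 2 = heronPoly K x.a x.d x.e
  heron_r : x.r ^ 2 = heronPoly K x.a x.b x.f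
  heron_s : x.s ^ 2 = heronPoly K x.c x.d x.f
  add_eq : x.p + x.q = x.r + x.s + K / 2 * (x.a * x.p + x.b * x.q - x.e * x.r)
  bretschneider : 4 * x.e * x.f * (1 - K * x.e / 4) =
    (x.p + x.q) ^ 2 + (x.a - x.b + x.c - x.d) ^ 2 - K * x.e * (x.a - x.b) * (x.c - x.d)
  sub_eq : x.e * (x.r - x.s) = x.p * (x.a - x.d) + x.q * (x.b - x.c)

/-- The spherical Cayley-Menger determinant `M^K_4(a, b, c, d, e, f)`. -/
def cayleyMenger (K : ℂ) (x : SixTuple) : ℂ :=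
  Matrix.det
    !![K / 2, 1, 1, 1, 1;
       1, 0, x.b, x.e, x.a;
       1, x.b, 0, x.c, x.f;
       1, x.e, x.c, 0, x.d;
       1, x.a, x.f, x.d, 0]

/-- The six numbers form a spherical Cayley-Menger diamond. -/
def IsCayleyMengerDiamond (K : ℂ) (x : SixTuple) : Prop :=
  cayleyMenger K x = 0

/-- `∂M^K_4 / ∂a`, the partial derivative in the top entry. -/
def partialTop (K : ℂ) (x : SixTuple) : ℂ :=
  deriv (fun t => cayleyMenger K { x with a := t }) x.a

/-- `∂M^K_4 / ∂c`, the partial derivative in the bottom entry. -/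
def partialBottom (K : ℂ) (x : SixTuple) : ℂ :=
  deriv (fun t => cayleyMenger K { x with c := t }) x.c

/-- `∂M^K_4 / ∂e`, the partial derivative in the left entry. -/
def partialLeft (K : ℂ) (x : SixTuple) : ℂ :=
  deriv (fun t => cayleyMenger K { x with e := t }) x.e

/-- `∂M^K_4 / ∂f`, the partial derivative in the right entry. -/
def partialRight (K : ℂ) (x : SixTuple) : ℂ :=
  deriv (fun t => cayleyMenger K { x with f := t }) x.f

/-- The index set `I_n` of a spherical Heronian frieze of order `n`: the integer nodes `(i, j)` and
the half-integer nodes `(i + 1/2, j)` and `(i, j + 1/2)` that lie in the strip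
`0 ≤ (second coordinate) - (first coordinate) ≤ n`, and the two families of lines. -/
inductive HeronianIndex (n : ℕ) : Type
  /-- The integer node `(i, j)`. -/
  | node (i j : ℤ) (h : 0 ≤ j - i ∧ j - i ≤ n)
  /-- The half-integer node `(i + 1/2, j)`. -/
  | halfFst (i j : ℤ) (h : 1 ≤ j - i ∧ j - i ≤ n)
  /-- The half-integer node `(i, j + 1/2)`. -/
  | halfSnd (i j : ℤ) (h : 0 ≤ j - i ∧ j - i ≤ n - 1)
  /-- The line `(i + 1/2, ⟋)`. -/
  | lineNE (i : ℤ)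
  /-- The line `(⟍, j + 1/2)`. -/
  | lineSE (j : ℤ)

/-- The index set `I_n^SCM` of a spherical Cayley-Menger frieze of order `n`. -/
inductive CMIndex (n : ℕ) : Type
  /-- The integer node `(i, j)`. -/
  | node (i j : ℤ) (h : 0 ≤ j - i ∧ j - i ≤ n)
  /-- The line `(i + 1/2, ⟋)`. -/
  | lineNE (i : ℤ)
  /-- The line `(⟍, j + 1/2)`. -/
  | lineSE (j : ℤ)

/-- The inclusion of `I_n^SCM` into `I_n`. -/
def CMIndex.toHeronianIndex {n : ℕ} : CMIndex n → HeronianIndex n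
  | .node i j h => .node i j h
  | .lineNE i => .lineNE i
  | .lineSE j => .lineSE j

/-- The restriction to `I_n^SCM` of an array indexed by `I_n`. -/
def restrict {n : ℕ} (z : HeronianIndex n → ℂ) : CMIndex n → ℂ :=
  fun α => z α.toHeronianIndex

/-- The array obtained by changing the sign of all entries indexed by `I_n \ I_n^SCM`. -/
def signChange {n : ℕ} (z : HeronianIndex n → ℂ) : HeronianIndex n → ℂ
  | .node i j h => z (.node i j h)
  | .halfFst i j h => -z (.halfFst i j h)
  | .halfSnd i j h => -z (.halfSnd i j h)
  | .lineNE i => z (.lineNE i)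
  | .lineSE j => z (.lineSE j)

/-- The ten entries of the diamond whose left corner is the interior node `(i, j)`. -/
def heronianDiamond {n : ℕ} (z : HeronianIndex n → ℂ) (i j : ℤ)
    (h : 1 ≤ j - i ∧ j - i ≤ n - 1) : TenTuple where
  a := z (.node i (j + 1) (by omega))
  b := z (.lineNE i)
  c := z (.node (i + 1) j (by omega))
  d := z (.lineSE j)
  e := z (.node i j (by omega))
  f := z (.node (i + 1) (j + 1) (by omega))
  p := z (.halfFst i j (by omega))
  q := z (.halfSnd i j (by omega))
  r := z (.halfFst i (j + 1) (by omega))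
  s := z (.halfSnd (i + 1) j (by omega))

/-- The six entries of the diamond whose left corner is the interior node `(i, j)`. -/
def cmDiamond {n : ℕ} (z : CMIndex n → ℂ) (i j : ℤ)
    (h : 1 ≤ j - i ∧ j - i ≤ n - 1) : SixTuple where
  a := z (.node i (j + 1) (by omega))
  b := z (.lineNE i)
  c := z (.node (i + 1) j (by omega))
  d := z (.lineSE j)
  e := z (.node i j (by omega))
  f := z (.node (i + 1) (j + 1) (by omega))

/-- `z` is a spherical Heronian frieze (of order `n`): every diamond is a spherical Heronian
diamond, and all entries in the two boundary rows of integer nodes, and at the half-integer nodes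
next to them, vanish. -/
structure IsHeronianFrieze (K : ℂ) {n : ℕ} (z : HeronianIndex n → ℂ) : Prop where
  diamond : ∀ (i j : ℤ) (h : 1 ≤ j - i ∧ j - i ≤ n - 1),
    IsHeronianDiamond K (heronianDiamond z i j h)
  /-- `z_(i, i) = 0` -/
  bottom : ∀ (i j : ℤ) (h : j - i = 0), z (.node i j (by omega)) = 0
  /-- `z_(i, i + n) = 0` -/
  top : ∀ (i j : ℤ) (h : j - i = n), z (.node i j (by omega)) = 0
  /-- `z_(i + 1/2, i + 1) = 0` -/
  bottom_halfFst : ∀ (i j : ℤ) (h : j - i = 1) (hn : 1 ≤ n), z (.halfFst i j (by omega)) = 0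
  /-- `z_(i, i + 1/2) = 0` -/
  bottom_halfSnd : ∀ (i j : ℤ) (h : j - i = 0) (hn : 1 ≤ n), z (.halfSnd i j (by omega)) = 0
  /-- `z_(i + 1/2, i + n) = 0` -/
  top_halfFst : ∀ (i j : ℤ) (h : j - i = n) (hn : 1 ≤ n), z (.halfFst i j (by omega)) = 0
  /-- `z_(i, i + n - 1/2) = 0` -/
  top_halfSnd : ∀ (i j : ℤ) (h : j - i = n - 1) (hn : 1 ≤ n), z (.halfSnd i j (by omega)) = 0

/-- `z` is a spherical Cayley-Menger frieze (of order `n`). -/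
structure IsCMFrieze (K : ℂ) {n : ℕ} (z : CMIndex n → ℂ) : Prop where
  diamond : ∀ (i j : ℤ) (h : 1 ≤ j - i ∧ j - i ≤ n - 1),
    IsCayleyMengerDiamond K (cmDiamond z i j h)
  /-- `z_(i, i) = 0` -/
  bottom : ∀ (i j : ℤ) (h : j - i = 0), z (.node i j (by omega)) = 0
  /-- `z_(i, i + n) = 0` -/
  top : ∀ (i j : ℤ) (h : j - i = n), z (.node i j (by omega)) = 0
  /-- `z_(i, i + 1) = z_(i + 1/2, ⟋)` -/
  bottom_lineNE : ∀ (i j : ℤ) (h : j - i = 1) (hn : 1 ≤ n),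
    z (.node i j (by omega)) = z (.lineNE i)
  /-- `z_(i, i + 1) = z_(⟍, i + 1/2)` -/
  bottom_lineSE : ∀ (i j : ℤ) (h : j - i = 1) (hn : 1 ≤ n),
    z (.node i j (by omega)) = z (.lineSE i)
  /-- `z_(i, i + n - 1) = z_(i - 1/2, ⟋)` -/
  top_lineNE : ∀ (i j : ℤ) (h : j - i = n - 1) (hn : 1 ≤ n),
    z (.node i j (by omega)) = z (.lineNE (i - 1))
  /-- `z_(i, i + n - 1) = z_(⟍, i + n - 1/2)` -/
  top_lineSE : ∀ (i j : ℤ) (h : j - i = n - 1) (hn : 1 ≤ n),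
    z (.node i j (by omega)) = z (.lineSE j)

/-- The coherence condition at every node `(i, j)` with `2 ≤ j - i ≤ n - 2`, for the four diamonds
that share this node. -/
def IsCoherent (K : ℂ) {n : ℕ} (z : CMIndex n → ℂ) : Prop :=
  ∀ (i j : ℤ) (h : 2 ≤ j - i ∧ j - i ≤ n - 2),
    partialLeft K (cmDiamond z (i - 1) (j - 1) (by omega)) *
        partialRight K (cmDiamond z i j (by omega)) =
      partialTop K (cmDiamond z (i - 1) j (by omega)) *
        partialBottom K (cmDiamond z i (j - 1) (by omega))

/-- `z_(i, j) ∉ {0, 4/K}` whenever `2 ≤ j - i ≤ n - 2`. The condition `z_(i, j) ≠ 4/K` is written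
as `K * z_(i, j) ≠ 4`, which is vacuous for `K = 0`. -/
def InteriorNonvanishing (K : ℂ) {n : ℕ} (z : CMIndex n → ℂ) : Prop :=
  ∀ (i j : ℤ) (h : 2 ≤ j - i ∧ j - i ≤ n - 2),
    z (.node i j (by omega)) ≠ 0 ∧ K * z (.node i j (by omega)) ≠ 4

/-- Both Heron polynomials attached to `(i, j)` are nonzero whenever `2 ≤ j - i ≤ n - 1`. -/
def HeronNonvanishing (K : ℂ) {n : ℕ} (z : CMIndex n → ℂ) : Prop :=
  ∀ (i j : ℤ) (h : 2 ≤ j - i ∧ j - i ≤ n - 1),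
    heronPoly K (z (.node i j (by omega))) (z (.node (i + 1) j (by omega))) (z (.lineNE i)) ≠ 0 ∧
    heronPoly K (z (.node i (j - 1) (by omega))) (z (.node i j (by omega)))
      (z (.lineSE (j - 1))) ≠ 0

end SphericalFrieze

end

/-!
The passage between the two kinds of friezes is governed by one fact about a single diamond. Write
`M` for the Cayley-Menger determinant and `p, q, r, s` for the numbers at the sides. By Jacobi's
identity for minors, the square of half of `∂M/∂f` is, modulo `M`, the product of the two Heron
polynomials `p²` and `q²`; likewise for the other corners. The equations of a Heronian diamond say
which square root is meant:
`ps = ½ ∂M/∂a`, `qr = ½ ∂M/∂c`, `rs = -½ ∂M/∂e`, `pq = -½ ∂M/∂f`.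
Indeed the Bretschneider equation is the last of these, and it forces `M = 0` when `e ≠ 0` and
`K e ≠ 4`; the two remaining equations are then linear in `r` and `s` with nonzero determinant, and
solving them gives the other products (`IsHeronianDiamond.hasMinorProducts`). Conversely, if
`M = 0` and `p, q ≠ 0`, the products imply the equations (`isHeronianDiamond_of_mul_eq`). In the
first and last rows the condition on `e` is not available, but there the diamond degenerates
and can be treated by hand.

For a Heronian frieze, both sides of the coherence relation at a node are therefore the product of
the four half-integer entries around that node
(`IsHeronianFrieze.isCoherent_restrict`).

In the other direction the squares of the half-integer entries are known and nonzero, and the signs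
must be chosen so that two entries at adjacent sides of a diamond have the prescribed product. The
relations inside a diamond are consistent because the adjugate of a singular matrix has rank at most
one, so that `∂M/∂e · ∂M/∂f = ∂M/∂a · ∂M/∂c`; those around a node are consistent by coherence.
Since the strip is simply connected and its sides are linked by these relations, a choice of one
entry extends to all others in exactly one way (`IsSideData.exists_isSideSystem`,
`IsSideSystem.eq_or_eq_neg`).
-/

noncomputable section

namespace SphericalFrieze

/-! ### The Cayley-Menger determinant of a diamond -/

theorem cayleyMenger_eq (K : ℂ) (x : SixTuple) :
    cayleyMenger K x =
      K / 2 * (x.a ^ 2 * x.c ^ 2 + x.b ^ 2 * x.d ^ 2 + x.e ^ 2 * x.f ^ 2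
        - 2 * x.a * x.b * x.c * x.d - 2 * x.a * x.c * x.e * x.f - 2 * x.b * x.d * x.e * x.f)
      - 2 * (x.a * x.c * (x.a + x.c - x.b - x.d - x.e - x.f)
        + x.b * x.d * (x.b + x.d - x.a - x.c - x.e - x.f)
        + x.e * x.f * (x.e + x.f - x.a - x.b - x.c - x.d)
        + x.a * x.b * x.f + x.a * x.d * x.e + x.b * x.c * x.e + x.c * x.d * x.f) := by
  simp [cayleyMenger, Matrix.det_succ_row_zero, Fin.sum_univ_succ, Fin.succAbove]
  ring

/-- Half of `∂M/∂a`, as a polynomial. -/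
def halfPartialTop (K : ℂ) (x : SixTuple) : ℂ :=
  K / 2 * x.c * (x.a * x.c - x.b * x.d - x.e * x.f)
    - x.c * (2 * x.a + x.c - x.b - x.d - x.e - x.f) + x.b * x.d + x.e * x.f
    - x.b * x.f - x.d * x.e

/-- Half of `∂M/∂c`, as a polynomial. -/
def halfPartialBottom (K : ℂ) (x : SixTuple) : ℂ :=
  K / 2 * x.a * (x.a * x.c - x.b * x.d - x.e * x.f)
    - x.a * (2 * x.c + x.a - x.b - x.d - x.e - x.f) + x.b * x.d + x.e * x.f
    - x.b * x.e - x.d * x.f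

/-- Half of `∂M/∂e`, as a polynomial. -/
def halfPartialLeft (K : ℂ) (x : SixTuple) : ℂ :=
  K / 2 * x.f * (x.e * x.f - x.a * x.c - x.b * x.d)
    - x.f * (2 * x.e + x.f - x.a - x.b - x.c - x.d) + x.a * x.c + x.b * x.d
    - x.a * x.d - x.b * x.c

/-- Half of `∂M/∂f`, as a polynomial. -/
def halfPartialRight (K : ℂ) (x : SixTuple) : ℂ :=
  K / 2 * x.e * (x.e * x.f - x.a * x.c - x.b * x.d)
    - x.e * (2 * x.f + x.e - x.a - x.b - x.c - x.d) + x.a * x.c + x.b * x.d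
    - x.a * x.b - x.c * x.d

/-- Half of `∂M/∂d`, the partial derivative in the label of the second line, as a polynomial. -/
def halfPartialLine (K : ℂ) (x : SixTuple) : ℂ :=
  K / 2 * x.b * (x.b * x.d - x.a * x.c - x.e * x.f)
    - x.b * (2 * x.d + x.b - x.a - x.c - x.e - x.f) + x.a * x.c + x.e * x.f
    - x.a * x.e - x.c * x.f

theorem deriv_eq_of_eq_quadratic {g : ℂ → ℂ} {u v w : ℂ} (h : ∀ t, g t = u * t ^ 2 + v * t + w)
    (x : ℂ) : deriv g x = 2 * u * x + v := by
  have hg : g = fun t => u * t ^ 2 + v * t + w := funext h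
  have hd : HasDerivAt g (u * (2 * x) + v) x := by
    rw [hg]
    simpa using ((((hasDerivAt_id x).pow 2).const_mul u).add
      ((hasDerivAt_id x).const_mul v)).add_const w
  rw [hd.deriv]
  ring

theorem partialTop_eq (K : ℂ) (x : SixTuple) : partialTop K x = 2 * halfPartialTop K x := by
  rw [partialTop, deriv_eq_of_eq_quadratic (u := K / 2 * x.c ^ 2 - 2 * x.c)
    (v := 2 * halfPartialTop K { x with a := 0 }) (w := cayleyMenger K { x with a := 0 })]
  · simp only [halfPartialTop]; ring
  · intro t; simp only [cayleyMenger_eq, halfPartialTop]; ring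

theorem partialBottom_eq (K : ℂ) (x : SixTuple) :
    partialBottom K x = 2 * halfPartialBottom K x := by
  rw [partialBottom, deriv_eq_of_eq_quadratic (u := K / 2 * x.a ^ 2 - 2 * x.a)
    (v := 2 * halfPartialBottom K { x with c := 0 }) (w := cayleyMenger K { x with c := 0 })]
  · simp only [halfPartialBottom]; ring
  · intro t; simp only [cayleyMenger_eq, halfPartialBottom]; ring

theorem partialLeft_eq (K : ℂ) (x : SixTuple) : partialLeft K x = 2 * halfPartialLeft K x := by
  rw [partialLeft, deriv_eq_of_eq_quadratic (u := K / 2 * x.f ^ 2 - 2 * x.f)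
    (v := 2 * halfPartialLeft K { x with e := 0 }) (w := cayleyMenger K { x with e := 0 })]
  · simp only [halfPartialLeft]; ring
  · intro t; simp only [cayleyMenger_eq, halfPartialLeft]; ring

theorem partialRight_eq (K : ℂ) (x : SixTuple) :
    partialRight K x = 2 * halfPartialRight K x := by
  rw [partialRight, deriv_eq_of_eq_quadratic (u := K / 2 * x.e ^ 2 - 2 * x.e)
    (v := 2 * halfPartialRight K { x with f := 0 }) (w := cayleyMenger K { x with f := 0 })]
  · simp only [halfPartialRight]; ring
  · intro t; simp only [cayleyMenger_eq, halfPartialRight]; ring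

/-! ### Jacobi's identities for the minors -/

theorem halfPartialTop_sq (K : ℂ) (x : SixTuple) :
    halfPartialTop K x ^ 2 = heronPoly K x.b x.c x.e * heronPoly K x.c x.d x.f
      + cayleyMenger K x * (K / 2 * x.c ^ 2 - 2 * x.c) := by
  simp only [halfPartialTop, heronPoly, cayleyMenger_eq]; ring

theorem halfPartialBottom_sq (K : ℂ) (x : SixTuple) :
    halfPartialBottom K x ^ 2 = heronPoly K x.a x.d x.e * heronPoly K x.a x.b x.f
      + cayleyMenger K x * (K / 2 * x.a ^ 2 - 2 * x.a) := by
  simp only [halfPartialBottom, heronPoly, cayleyMenger_eq]; ring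

theorem halfPartialRight_sq (K : ℂ) (x : SixTuple) :
    halfPartialRight K x ^ 2 = heronPoly K x.b x.c x.e * heronPoly K x.a x.d x.e
      + cayleyMenger K x * (K / 2 * x.e ^ 2 - 2 * x.e) := by
  simp only [halfPartialRight, heronPoly, cayleyMenger_eq]; ring

theorem halfPartialLeft_mul_halfPartialRight (K : ℂ) (x : SixTuple) :
    halfPartialLeft K x * halfPartialRight K x = halfPartialTop K x * halfPartialBottom K x
      + cayleyMenger K x * (K / 2 * (x.e * x.f - x.a * x.c) + x.a + x.c - x.e - x.f) := by
  simp only [halfPartialTop, halfPartialBottom, halfPartialLeft, halfPartialRight,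
    cayleyMenger_eq]
  ring

theorem halfPartialBottom_mul_halfPartialRight (K : ℂ) (x : SixTuple) :
    halfPartialBottom K x * halfPartialRight K x
      = -(halfPartialLine K x * heronPoly K x.a x.d x.e)
        - cayleyMenger K x * (K / 2 * x.a * x.e - x.a + x.d - x.e) := by
  simp only [halfPartialBottom, halfPartialRight, halfPartialLine, heronPoly, cayleyMenger_eq]
  ring

/-! ### Heronian diamonds and products of minors -/

/-- The products of the numbers at two sides of the diamond that share a corner are, up to sign,
half of the partial derivative of `M` in the entry at the opposite corner. -/
structure HasMinorProducts (K : ℂ) (x : TenTuple) : Prop where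
  top : x.p * x.s = halfPartialTop K x.toSixTuple
  bottom : x.q * x.r = halfPartialBottom K x.toSixTuple
  left : x.r * x.s = -halfPartialLeft K x.toSixTuple
  right : x.p * x.q = -halfPartialRight K x.toSixTuple

namespace IsHeronianDiamond

variable {K : ℂ} {x : TenTuple}

/-- The Bretschneider equation is linear in the right entry once `p²` and `q²` are replaced by
Heron polynomials. -/
theorem mul_eq_right (h : IsHeronianDiamond K x) :
    x.p * x.q = -halfPartialRight K x.toSixTuple := by
  have hp := h.heron_p
  have hq := h.heron_q
  have hb := h.bretschneider
  simp only [heronPoly] at hp hq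
  simp only [halfPartialRight]
  linear_combination (-1 / 2) * hb - (1 / 2) * hp - (1 / 2) * hq

theorem cayleyMenger_eq_zero (h : IsHeronianDiamond K x) (he : x.e ≠ 0) (hK : K * x.e ≠ 4) :
    cayleyMenger K x.toSixTuple = 0 := by
  have hsq := halfPartialRight_sq K x.toSixTuple
  rw [← h.heron_p, ← h.heron_q] at hsq
  have hz : cayleyMenger K x.toSixTuple * (x.e * (K * x.e - 4)) = 0 := by
    have hpq := h.mul_eq_right
    linear_combination (-2) * hsq - 2 * (x.p * x.q - halfPartialRight K x.toSixTuple) * hpq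
  exact (mul_eq_zero.1 hz).resolve_right (mul_ne_zero he (sub_ne_zero.2 hK))

/-- The equations `add_eq` and `sub_eq` are linear in `r` and `s`, with determinant
`-e (2 - K e / 2)`; solving them writes every product of two sides through `p²`, `q²` and `pq`. -/
theorem hasMinorProducts (h : IsHeronianDiamond K x) (he : x.e ≠ 0) (hK : K * x.e ≠ 4) :
    HasMinorProducts K x := by
  have hM := h.cayleyMenger_eq_zero he hK
  have hpq := h.mul_eq_right
  have hadd := h.add_eq
  have hsub := h.sub_eq
  have ht : x.e * (2 - K / 2 * x.e) ≠ 0 :=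
    mul_ne_zero he fun h0 => hK (by linear_combination (-2) * h0)
  have hr : x.e * (2 - K / 2 * x.e) * x.r =
      (x.e * (1 - K / 2 * x.a) + (x.a - x.d)) * x.p
        + (x.e * (1 - K / 2 * x.b) + (x.b - x.c)) * x.q := by
    linear_combination hsub - x.e * hadd
  have hs : x.e * (2 - K / 2 * x.e) * x.s =
      (x.e * (1 - K / 2 * x.a) - (1 - K / 2 * x.e) * (x.a - x.d)) * x.p
        + (x.e * (1 - K / 2 * x.b) - (1 - K / 2 * x.e) * (x.b - x.c)) * x.q := by
    linear_combination -(1 - K / 2 * x.e) * hsub - x.e * hadd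
  have hp := h.heron_p
  have hq := h.heron_q
  have top : x.p * x.s = halfPartialTop K x.toSixTuple := by
    apply mul_left_cancel₀ ht
    have key : (x.e * (1 - K / 2 * x.a) - (1 - K / 2 * x.e) * (x.a - x.d)) *
          heronPoly K x.b x.c x.e
        - (x.e * (1 - K / 2 * x.b) - (1 - K / 2 * x.e) * (x.b - x.c)) *
          halfPartialRight K x.toSixTuple
        = x.e * (2 - K / 2 * x.e) * halfPartialTop K x.toSixTuple := by
      simp only [halfPartialRight, halfPartialTop, heronPoly]; ring
    linear_combination key + x.p * hs
      + (x.e * (1 - K / 2 * x.a) - (1 - K / 2 * x.e) * (x.a - x.d)) * hp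
      + (x.e * (1 - K / 2 * x.b) - (1 - K / 2 * x.e) * (x.b - x.c)) * hpq
  have bottom : x.q * x.r = halfPartialBottom K x.toSixTuple := by
    apply mul_left_cancel₀ ht
    have key : -(x.e * (1 - K / 2 * x.a) + (x.a - x.d)) * halfPartialRight K x.toSixTuple
        + (x.e * (1 - K / 2 * x.b) + (x.b - x.c)) * heronPoly K x.a x.d x.e
        = x.e * (2 - K / 2 * x.e) * halfPartialBottom K x.toSixTuple := by
      simp only [halfPartialRight, halfPartialBottom, heronPoly]; ring
    linear_combination key + x.q * hr
      + (x.e * (1 - K / 2 * x.a) + (x.a - x.d)) * hpq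
      + (x.e * (1 - K / 2 * x.b) + (x.b - x.c)) * hq
  have line : x.r * x.p = halfPartialLine K x.toSixTuple := by
    apply mul_left_cancel₀ ht
    have key : (x.e * (1 - K / 2 * x.a) + (x.a - x.d)) * heronPoly K x.b x.c x.e
        - (x.e * (1 - K / 2 * x.b) + (x.b - x.c)) * halfPartialRight K x.toSixTuple
        = x.e * (2 - K / 2 * x.e) * halfPartialLine K x.toSixTuple := by
      simp only [halfPartialRight, halfPartialLine, heronPoly]; ring
    linear_combination key + x.p * hr
      + (x.e * (1 - K / 2 * x.a) + (x.a - x.d)) * hp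
      + (x.e * (1 - K / 2 * x.b) + (x.b - x.c)) * hpq
  refine ⟨top, bottom, ?_, hpq⟩
  -- Multiplying `add_eq` by `r` expresses `rs` through products that are known already.
  have key : halfPartialLine K x.toSixTuple + halfPartialBottom K x.toSixTuple
      - heronPoly K x.a x.b x.f
      - K / 2 * (x.a * halfPartialLine K x.toSixTuple + x.b * halfPartialBottom K x.toSixTuple
        - x.e * heronPoly K x.a x.b x.f) = -halfPartialLeft K x.toSixTuple := by
    simp only [halfPartialLine, halfPartialBottom, halfPartialLeft, heronPoly]; ring
  linear_combination key - x.r * hadd + (1 - K / 2 * x.a) * line + (1 - K / 2 * x.b) * bottom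
    - (1 - K / 2 * x.e) * h.heron_r

end IsHeronianDiamond

/-- A Cayley-Menger diamond with square roots of its four Heron polynomials is a Heronian diamond
as soon as the three products that involve `p` or `q` have the right signs. -/
theorem isHeronianDiamond_of_mul_eq {K : ℂ} {x : TenTuple}
    (hM : cayleyMenger K x.toSixTuple = 0)
    (hp : x.p ^ 2 = heronPoly K x.b x.c x.e) (hq : x.q ^ 2 = heronPoly K x.a x.d x.e)
    (hr : x.r ^ 2 = heronPoly K x.a x.b x.f) (hs : x.s ^ 2 = heronPoly K x.c x.d x.f)
    (hp0 : x.p ≠ 0) (hq0 : x.q ≠ 0)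
    (top : x.p * x.s = halfPartialTop K x.toSixTuple)
    (bottom : x.q * x.r = halfPartialBottom K x.toSixTuple)
    (right : x.p * x.q = -halfPartialRight K x.toSixTuple) : IsHeronianDiamond K x := by
  have line : x.p * x.r = halfPartialLine K x.toSixTuple := by
    apply mul_left_cancel₀ (pow_ne_zero 2 hq0)
    have h := halfPartialBottom_mul_halfPartialRight K x.toSixTuple
    rw [hM, ← hq, ← bottom] at h
    linear_combination x.q * x.r * right - h
  refine ⟨hp, hq, hr, hs, ?_, ?_, ?_⟩
  · apply mul_left_cancel₀ hp0
    have key : heronPoly K x.b x.c x.e - halfPartialRight K x.toSixTuple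
        = halfPartialLine K x.toSixTuple + halfPartialTop K x.toSixTuple
          + K / 2 * (x.a * heronPoly K x.b x.c x.e - x.b * halfPartialRight K x.toSixTuple
            - x.e * halfPartialLine K x.toSixTuple) := by
      simp only [halfPartialRight, halfPartialTop, halfPartialLine, heronPoly]; ring
    linear_combination key + (1 - K / 2 * x.a) * hp + (1 - K / 2 * x.b) * right
      - (1 - K / 2 * x.e) * line - top
  · simp only [heronPoly] at hp hq
    simp only [halfPartialRight] at right
    linear_combination -hp - hq - 2 * right
  · apply mul_left_cancel₀ hp0
    have key : x.e * (halfPartialLine K x.toSixTuple - halfPartialTop K x.toSixTuple)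
        = heronPoly K x.b x.c x.e * (x.a - x.d)
          - halfPartialRight K x.toSixTuple * (x.b - x.c) := by
      simp only [halfPartialRight, halfPartialTop, halfPartialLine, heronPoly]; ring
    linear_combination key + x.e * line - x.e * top - (x.a - x.d) * hp - (x.b - x.c) * right

/-! ### Choosing square roots along the strip -/

/-- The numerical data from which the half-integer entries are to be reconstructed. The entry at
`(i + 1/2, j)` has square `H i j`, the entry at `(i, j + 1/2)` has square `G i j`, and
`A i j, C i j, -E i j, -F i j` are the products of two sides of the diamond with left corner
`(i, j)` that meet at its bottom, top, right and left corner, respectively. The field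
`coherent` compares the four products around the node `(i + 1, j + 1)`. -/
structure IsSideData (n : ℕ) (H G A C E F : ℤ → ℤ → ℂ) : Prop where
  fst_ne_zero : ∀ i j : ℤ, 2 ≤ j - i → j - i ≤ n - 1 → H i j ≠ 0
  snd_ne_zero : ∀ i j : ℤ, 1 ≤ j - i → j - i ≤ n - 2 → G i j ≠ 0
  start_fst : ∀ i : ℤ, C i (i + 1) = H i (i + 2)
  start_snd : ∀ i : ℤ, C i (i + 1) = G i (i + 1)
  right_sq : ∀ i j : ℤ, 2 ≤ j - i → j - i ≤ n - 2 → F i j ^ 2 = H i j * G i j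
  bottom_sq : ∀ i j : ℤ, 1 ≤ j - i → j - i ≤ n - 2 → C i j ^ 2 = G i j * H i (j + 1)
  top_sq : ∀ i j : ℤ, 2 ≤ j - i → j - i ≤ n - 1 → A i j ^ 2 = H i j * G (i + 1) j
  left_mul_right : ∀ i j : ℤ, 2 ≤ j - i → j - i ≤ n - 2 → E i j * F i j = A i j * C i j
  coherent : ∀ i j : ℤ, 2 ≤ j - i → j - i ≤ n - 2 →
    E i j * F (i + 1) (j + 1) = A i (j + 1) * C (i + 1) j

/-- `X i j` and `Y i j` are the entries at `(i + 1/2, j)` and `(i, j + 1/2)`: square roots of the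
prescribed numbers, with prescribed products along the sides of each diamond. -/
structure IsSideSystem (n : ℕ) (H G A C F X Y : ℤ → ℤ → ℂ) : Prop where
  fst_sq : ∀ i j : ℤ, 2 ≤ j - i → j - i ≤ n - 1 → X i j ^ 2 = H i j
  snd_sq : ∀ i j : ℤ, 1 ≤ j - i → j - i ≤ n - 2 → Y i j ^ 2 = G i j
  right : ∀ i j : ℤ, 2 ≤ j - i → j - i ≤ n - 2 → X i j * Y i j = -F i j
  bottom : ∀ i j : ℤ, 1 ≤ j - i → j - i ≤ n - 2 → Y i j * X i (j + 1) = C i j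
  top : ∀ i j : ℤ, 2 ≤ j - i → j - i ≤ n - 1 → X i j * Y (i + 1) j = A i j

/-- A two-sided sequence can be defined by a recursion whose steps are bijections. -/
theorem exists_int_seq {α : Type*} (e : ℤ → α ≃ α) (a : α) :
    ∃ g : ℤ → α, g 0 = a ∧ ∀ i, g (i + 1) = e i (g i) := by
  let u : ℕ → α := fun m => Nat.rec a (fun k x => e k x) m
  let v : ℕ → α := fun m => Nat.rec a (fun k x => (e (-(k : ℤ) - 1)).symm x) m
  refine ⟨fun i => if 0 ≤ i then u i.toNat else v (-i).toNat, by simp [u], fun i => ?_⟩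
  rcases le_or_gt 0 i with hi | hi
  · lift i to ℕ using hi
    have h1 : ((i : ℤ) + 1).toNat = i + 1 := by omega
    have h2 : (0 : ℤ) ≤ i + 1 := by omega
    simp [h1, h2, u]
  · obtain ⟨k, rfl⟩ : ∃ k : ℕ, i = -(k : ℤ) - 1 := ⟨(-i - 1).toNat, by omega⟩
    have h1 : ¬ (0 : ℤ) ≤ -(k : ℤ) - 1 := by omega
    have h2 : (-(-(k : ℤ) - 1)).toNat = k + 1 := by omega
    have hv : v (k + 1) = (e (-(k : ℤ) - 1)).symm (v k) := rfl
    rcases Nat.eq_zero_or_pos k with rfl | hk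
    · simp [u, v]
    · have h3 : ¬ (0 : ℤ) ≤ -(k : ℤ) - 1 + 1 := by omega
      have h4 : (-(-(k : ℤ) - 1 + 1)).toNat = k := by omega
      simp only [h1, h2, h3, h4, if_false, hv, Equiv.apply_symm_apply]

/-- The recursion `t (i + 1) = c i / t i` has a two-sided solution with any initial value. -/
theorem exists_int_seq_div (c : ℤ → ℂ) (hc : ∀ i, c i ≠ 0) (a : ℂ) :
    ∃ t : ℤ → ℂ, t 0 = a ∧ ∀ i, t (i + 1) = c i / t i :=
  exists_int_seq (fun i => Function.Involutive.toPerm (fun t => c i / t)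
    fun _ => div_div_cancel₀ (hc i)) a

namespace IsSideData

variable {n : ℕ} {H G A C E F : ℤ → ℤ → ℂ}

theorem right_ne_zero (h : IsSideData n H G A C E F) (i j : ℤ) (h1 : 2 ≤ j - i)
    (h2 : j - i ≤ n - 2) : F i j ≠ 0 := fun h0 => by
  have := h.right_sq i j h1 h2
  rw [h0, zero_pow two_ne_zero] at this
  exact mul_ne_zero (h.fst_ne_zero i j h1 (by omega)) (h.snd_ne_zero i j (by omega) h2) this.symm

theorem bottom_ne_zero (h : IsSideData n H G A C E F) (i j : ℤ) (h1 : 1 ≤ j - i)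
    (h2 : j - i ≤ n - 2) : C i j ≠ 0 := fun h0 => by
  have := h.bottom_sq i j h1 h2
  rw [h0, zero_pow two_ne_zero] at this
  exact mul_ne_zero (h.snd_ne_zero i j h1 h2)
    (h.fst_ne_zero i (j + 1) (by omega) (by omega)) this.symm

theorem top_ne_zero (h : IsSideData n H G A C E F) (i j : ℤ) (h1 : 2 ≤ j - i)
    (h2 : j - i ≤ n - 1) : A i j ≠ 0 := fun h0 => by
  have := h.top_sq i j h1 h2
  rw [h0, zero_pow two_ne_zero] at this
  exact mul_ne_zero (h.fst_ne_zero i j h1 h2)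
    (h.snd_ne_zero (i + 1) j (by omega) (by omega)) this.symm

/-- The first entries of the strips of diamonds between consecutive lines `(i + 1/2, ⟋)`. -/
theorem exists_start (hn : 4 ≤ n) (h : IsSideData n H G A C E F) :
    ∃ t : ℤ → ℂ, (∀ i, t i ^ 2 = H i (i + 2)) ∧ ∀ i, t i * t (i + 1) = A i (i + 2) := by
  have hA : ∀ i, A i (i + 2) ≠ 0 := fun i => h.top_ne_zero i _ (by omega) (by omega)
  have hH : ∀ i, H i (i + 2) ≠ 0 := fun i => h.fst_ne_zero i _ (by omega) (by omega)
  have hAsq : ∀ i, A i (i + 2) ^ 2 = H i (i + 2) * H (i + 1) (i + 1 + 2) := fun i => by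
    rw [h.top_sq i _ (by omega) (by omega), ← h.start_fst (i + 1), h.start_snd (i + 1),
      show i + 1 + 1 = i + 2 by ring]
  obtain ⟨a, ha⟩ := IsAlgClosed.exists_pow_nat_eq (H 0 (0 + 2)) two_pos
  obtain ⟨t, ht0, ht⟩ := exists_int_seq_div (fun i => A i (i + 2)) hA a
  have hsq : ∀ i, t i ^ 2 = H i (i + 2) := by
    intro i
    induction i using Int.induction_on with
    | zero => rw [ht0, ha]
    | succ i ih => rw [ht, div_pow, ih, hAsq, mul_div_cancel_left₀ _ (hH _)]
    | pred i ih =>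
      have hs := ht (-(i : ℤ) - 1)
      have hAi := hAsq (-(i : ℤ) - 1)
      simp only [sub_add_cancel] at hs hAi
      rw [hs, div_pow, hAi] at ih
      have h0 : t (-(i : ℤ) - 1) ^ 2 ≠ 0 := fun h0 => by
        rw [h0, div_zero] at ih
        exact hH _ ih.symm
      rw [div_eq_iff h0, mul_comm] at ih
      exact (mul_left_cancel₀ (hH _) ih).symm
  refine ⟨t, hsq, fun i => ?_⟩
  have h0 : t i ≠ 0 := fun h0 => hH i (by rw [← hsq, h0, zero_pow two_ne_zero])
  rw [ht, mul_div_cancel₀ _ h0]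

/-- Square roots with compatible products exist. Within the strip between two consecutive lines
they are propagated upwards from the first entry; coherence is what makes the values that two
neighbouring strips give on their common line agree. -/
theorem exists_isSideSystem (hn : 4 ≤ n) (h : IsSideData n H G A C E F) :
    ∃ X Y, IsSideSystem n H G A C F X Y := by
  obtain ⟨t, htsq, htA⟩ := h.exists_start hn
  have ht0 : ∀ i, t i ≠ 0 := fun i h0 =>
    h.fst_ne_zero i (i + 2) (by omega) (by omega) (by rw [← htsq, h0, zero_pow two_ne_zero])
  -- `X i (j + 1) / X i j` is the quotient of the products at the top and the left corner of the
  -- diamond, `qr / pq = -C / F`.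
  let X : ℤ → ℤ → ℂ := fun i j => t i * ∏ l ∈ Finset.Ico (i + 2) j, (-C i l / F i l)
  let Y : ℤ → ℤ → ℂ := fun i j => C i j / X i (j + 1)
  have hXstart : ∀ i, X i (i + 2) = t i := fun i => by simp [X]
  have hXsucc : ∀ i j : ℤ, 2 ≤ j - i → X i (j + 1) = X i j * (-C i j / F i j) := fun i j hj => by
    have : Finset.Ico (i + 2) (j + 1) = insert j (Finset.Ico (i + 2) j) := by
      ext l; simp only [Finset.mem_Ico, Finset.mem_insert]; omega
    simp only [X]
    rw [this, Finset.prod_insert (by simp)]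
    ring
  have hXsq : ∀ i j : ℤ, 2 ≤ j - i → j - i ≤ n - 1 → X i j ^ 2 = H i j := by
    intro i j hj
    have hj' : i + 2 ≤ j := by omega
    clear hj
    induction j, hj' using Int.leInduction with
    | base => intro _; rw [hXstart, htsq]
    | succ j hj ih =>
      intro hn'
      have hF := h.right_sq i j (by omega) (by omega)
      have hC := h.bottom_sq i j (by omega) (by omega)
      rw [hXsucc i j (by omega), mul_pow, div_pow, neg_sq, ih (by omega), hF, hC]
      have h1 := h.fst_ne_zero i j (by omega) (by omega)
      have h2 := h.snd_ne_zero i j (by omega) (by omega)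
      field_simp
  have hX0 : ∀ i j : ℤ, 2 ≤ j - i → j - i ≤ n - 1 → X i j ≠ 0 := fun i j h1 h2 h0 =>
    h.fst_ne_zero i j h1 h2 (by rw [← hXsq i j h1 h2, h0, zero_pow two_ne_zero])
  have hbottom : ∀ i j : ℤ, 1 ≤ j - i → j - i ≤ n - 2 → Y i j * X i (j + 1) = C i j :=
    fun i j h1 h2 => div_mul_cancel₀ _ (hX0 i (j + 1) (by omega) (by omega))
  have hYsq : ∀ i j : ℤ, 1 ≤ j - i → j - i ≤ n - 2 → Y i j ^ 2 = G i j := fun i j h1 h2 => by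
    have h3 := h.fst_ne_zero i (j + 1) (by omega) (by omega)
    simp only [Y]
    rw [div_pow, hXsq i (j + 1) (by omega) (by omega), h.bottom_sq i j h1 h2,
      mul_div_cancel_right₀ _ h3]
  have hright : ∀ i j : ℤ, 2 ≤ j - i → j - i ≤ n - 2 → X i j * Y i j = -F i j := fun i j h1 h2 => by
    have hb := hbottom i j (by omega) h2
    have hF := h.right_ne_zero i j h1 h2
    apply mul_right_cancel₀ (h.bottom_ne_zero i j (by omega) h2)
    rw [hXsucc i j h1] at hb
    field_simp at hb
    linear_combination -hb
  refine ⟨X, Y, hXsq, hYsq, hright, hbottom, ?_⟩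
  intro i j hj
  have hj' : i + 2 ≤ j := by omega
  clear hj
  induction j, hj' using Int.leInduction with
  | base =>
    intro _
    have hY : Y (i + 1) (i + 2) = t (i + 1) := by
      have hb := hbottom (i + 1) (i + 2) (by omega) (by omega)
      have hs := h.start_fst (i + 1)
      rw [show i + 1 + 1 = i + 2 by ring] at hs
      rw [show i + 2 + 1 = i + 1 + 2 by ring, hXstart, hs, ← htsq, sq] at hb
      exact mul_right_cancel₀ (ht0 _) hb
    rw [hXstart, hY, htA]
  | succ j hj ih =>
    intro hn'
    have htop := ih (by omega)
    have h1 := hright i j (by omega) (by omega)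
    have h2 := hbottom i j (by omega) (by omega)
    have h3 := hright (i + 1) (j + 1) (by omega) (by omega)
    have h4 := hbottom (i + 1) j (by omega) (by omega)
    -- `E = -rs` is not prescribed, but follows from the other three products of the diamond.
    have hE : E i j = -(X i (j + 1) * Y (i + 1) j) := by
      apply mul_right_cancel₀ (h.right_ne_zero i j (by omega) (by omega))
      rw [h.left_mul_right i j (by omega) (by omega), ← htop, ← h2]
      linear_combination X i (j + 1) * Y (i + 1) j * h1
    have hcoh := h.coherent i j (by omega) (by omega)
    apply mul_right_cancel₀ (h.bottom_ne_zero (i + 1) j (by omega) (by omega))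
    rw [← hcoh, hE, ← h4]
    linear_combination X i (j + 1) * Y (i + 1) j * h3

end IsSideData

theorem eq_mul_of_mul_eq {ε x y x' y' c : ℂ} (hε : ε ^ 2 = 1) (hx : x ≠ 0)
    (h : x * y = c) (h' : x' * y' = c) (hxx : x' = ε * x) : y' = ε * y := by
  apply mul_left_cancel₀ hx
  subst hxx
  linear_combination ε * h' - x * y' * hε - ε * h

namespace IsSideSystem

variable {n : ℕ} {H G A C E F X Y X' Y' : ℤ → ℤ → ℂ}

theorem fst_ne_zero (hd : IsSideData n H G A C E F) (h : IsSideSystem n H G A C F X Y)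
    (i j : ℤ) (h1 : 2 ≤ j - i) (h2 : j - i ≤ n - 1) : X i j ≠ 0 := fun h0 =>
  hd.fst_ne_zero i j h1 h2 (by rw [← h.fst_sq i j h1 h2, h0, zero_pow two_ne_zero])

theorem snd_ne_zero (hd : IsSideData n H G A C E F) (h : IsSideSystem n H G A C F X Y)
    (i j : ℤ) (h1 : 1 ≤ j - i) (h2 : j - i ≤ n - 2) : Y i j ≠ 0 := fun h0 =>
  hd.snd_ne_zero i j h1 h2 (by rw [← h.snd_sq i j h1 h2, h0, zero_pow two_ne_zero])

/-- One entry determines all others, since any two entries are joined by a chain of entries in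
which neighbours have a prescribed product. -/
theorem eq_or_eq_neg (hn : 4 ≤ n) (hd : IsSideData n H G A C E F)
    (h : IsSideSystem n H G A C F X Y) (h' : IsSideSystem n H G A C F X' Y') :
    ∃ ε : ℂ, (ε = 1 ∨ ε = -1) ∧
      (∀ i j : ℤ, 2 ≤ j - i → j - i ≤ n - 1 → X' i j = ε * X i j) ∧
      ∀ i j : ℤ, 1 ≤ j - i → j - i ≤ n - 2 → Y' i j = ε * Y i j := by
  obtain ⟨ε, hε, h0⟩ : ∃ ε : ℂ, (ε = 1 ∨ ε = -1) ∧ X' 0 2 = ε * X 0 2 := by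
    have := (h'.fst_sq 0 2 (by omega) (by omega)).trans (h.fst_sq 0 2 (by omega) (by omega)).symm
    rcases sq_eq_sq_iff_eq_or_eq_neg.1 this with h0 | h0
    · exact ⟨1, Or.inl rfl, by rw [h0, one_mul]⟩
    · exact ⟨-1, Or.inr rfl, by rw [h0, neg_one_mul]⟩
  have hε2 : ε ^ 2 = 1 := by rcases hε with rfl | rfl <;> norm_num
  have hup : ∀ i j : ℤ, 1 ≤ j - i → j - i ≤ n - 2 → Y' i j = ε * Y i j →
      X' i (j + 1) = ε * X i (j + 1) := fun i j h1 h2 =>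
    eq_mul_of_mul_eq hε2 (snd_ne_zero hd h i j h1 h2) (h.bottom i j h1 h2) (h'.bottom i j h1 h2)
  have hdown : ∀ i j : ℤ, 1 ≤ j - i → j - i ≤ n - 2 → X' i (j + 1) = ε * X i (j + 1) →
      Y' i j = ε * Y i j := fun i j h1 h2 =>
    eq_mul_of_mul_eq hε2 (fst_ne_zero hd h i (j + 1) (by omega) (by omega))
      ((mul_comm _ _).trans (h.bottom i j h1 h2)) ((mul_comm _ _).trans (h'.bottom i j h1 h2))
  have hright : ∀ i j : ℤ, 2 ≤ j - i → j - i ≤ n - 2 → X' i j = ε * X i j →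
      Y' i j = ε * Y i j := fun i j h1 h2 =>
    eq_mul_of_mul_eq hε2 (fst_ne_zero hd h i j h1 (by omega)) (h.right i j h1 h2)
      (h'.right i j h1 h2)
  have hstart : ∀ i, X' i (i + 2) = ε * X i (i + 2) := by
    intro i
    induction i using Int.induction_on with
    | zero => exact h0
    | succ i ih =>
      have hY := eq_mul_of_mul_eq hε2 (fst_ne_zero hd h _ _ (by omega) (by omega))
        (h.top i (i + 2) (by omega) (by omega)) (h'.top i (i + 2) (by omega) (by omega)) ih
      have := hup (i + 1) (i + 2) (by omega) (by omega) hY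
      rwa [show (i : ℤ) + 2 + 1 = i + 1 + 2 by ring] at this
    | pred i ih =>
      have hY := hdown (-i) (-i + 1) (by omega) (by omega) (by
        rwa [show -(i : ℤ) + 1 + 1 = -i + 2 by ring])
      have h1 := h.top (-i - 1) (-i + 1) (by omega) (by omega)
      have h2 := h'.top (-i - 1) (-i + 1) (by omega) (by omega)
      rw [mul_comm, sub_add_cancel] at h1 h2
      have := eq_mul_of_mul_eq hε2 (snd_ne_zero hd h _ _ (by omega) (by omega)) h1 h2 hY
      rwa [show -(i : ℤ) + 1 = -i - 1 + 2 by ring] at this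
  have hX : ∀ i j : ℤ, 2 ≤ j - i → j - i ≤ n - 1 → X' i j = ε * X i j := by
    intro i j hj
    have hj' : i + 2 ≤ j := by omega
    clear hj
    induction j, hj' using Int.leInduction with
    | base => exact fun _ => hstart i
    | succ j hj ih =>
      exact fun hn' => hup i j (by omega) (by omega)
        (hright i j (by omega) (by omega) (ih (by omega)))
  exact ⟨ε, hε, hX, fun i j h1 h2 => hdown i j h1 h2 (hX i (j + 1) (by omega) (by omega))⟩

end IsSideSystem

/-! ### Heronian diamonds at the two boundaries of the strip -/

theorem cayleyMenger_of_bottom_eq_zero {K : ℂ} {x : SixTuple} (hc : x.c = 0) (hb : x.b = x.e)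
    (hd : x.d = x.f) : cayleyMenger K x = 0 := by
  simp only [cayleyMenger_eq, hc, hb, hd]; ring

theorem cayleyMenger_of_top_eq_zero {K : ℂ} {x : SixTuple} (ha : x.a = 0) (hb : x.b = x.f)
    (hd : x.d = x.e) : cayleyMenger K x = 0 := by
  simp only [cayleyMenger_eq, ha, hb, hd]; ring

theorem halfPartialBottom_of_bottom_eq_zero {K : ℂ} {x : SixTuple} (hc : x.c = 0)
    (hb : x.b = x.e) (hd : x.d = x.f) : halfPartialBottom K x = heronPoly K x.a x.d x.e := by
  simp only [halfPartialBottom, heronPoly, hc, hb, hd]; ring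

theorem halfPartialTop_of_top_eq_zero {K : ℂ} {x : SixTuple} (ha : x.a = 0)
    (hb : x.b = x.f) (hd : x.d = x.e) : halfPartialTop K x = heronPoly K x.b x.c x.e := by
  simp only [halfPartialTop, heronPoly, ha, hb, hd]; ring

namespace IsHeronianDiamond

variable {K : ℂ} {x : TenTuple}

theorem eq_of_bottom_eq_zero (h : IsHeronianDiamond K x) (hc : x.c = 0) (hp : x.p = 0)
    (hs : x.s = 0) : x.b = x.e ∧ x.d = x.f ∧ x.q = x.r := by
  have h1 := h.heron_p
  have h2 := h.heron_s
  have hadd := h.add_eq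
  have hsub := h.sub_eq
  have hbe : x.b = x.e := by
    rw [hp, hc] at h1
    simp only [heronPoly] at h1
    exact sub_eq_zero.1 (pow_eq_zero_iff two_ne_zero |>.1 (by linear_combination h1))
  have hdf : x.d = x.f := by
    rw [hs, hc] at h2
    simp only [heronPoly] at h2
    exact sub_eq_zero.1 (pow_eq_zero_iff two_ne_zero |>.1 (by linear_combination h2))
  rw [hp, hs, hbe] at hadd
  rw [hp, hs, hbe, hc] at hsub
  -- `(1 - K e / 2) (q - r) = 0` and `e (q - r) = 0` together give `q = r`.
  exact ⟨hbe, hdf, by linear_combination hadd - K / 2 * hsub⟩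

theorem eq_of_top_eq_zero (h : IsHeronianDiamond K x) (ha : x.a = 0) (hq : x.q = 0)
    (hr : x.r = 0) : x.b = x.f ∧ x.d = x.e ∧ x.p = x.s := by
  have h1 := h.heron_q
  have h2 := h.heron_r
  have hadd := h.add_eq
  rw [hq, ha] at h1
  rw [hr, ha] at h2
  simp only [heronPoly] at h1 h2
  rw [ha, hq, hr] at hadd
  refine ⟨?_, ?_, by linear_combination hadd⟩
  · exact sub_eq_zero.1 (pow_eq_zero_iff two_ne_zero |>.1 (by linear_combination h2))
  · exact sub_eq_zero.1 (pow_eq_zero_iff two_ne_zero |>.1 (by linear_combination h1))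

theorem of_bottom_eq_zero (hc : x.c = 0) (hp : x.p = 0) (hs : x.s = 0) (hb : x.b = x.e)
    (hd : x.d = x.f) (hqr : x.q = x.r) (hr : x.r ^ 2 = heronPoly K x.a x.b x.f) :
    IsHeronianDiamond K x := by
  simp only [heronPoly] at hr
  constructor <;> simp only [heronPoly, hc, hp, hs, hb, hd, hqr] at hr ⊢
  · ring
  · linear_combination hr
  · linear_combination hr
  · ring
  · ring
  · linear_combination -hr
  · ring

theorem of_top_eq_zero (ha : x.a = 0) (hq : x.q = 0) (hr : x.r = 0) (hb : x.b = x.f)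
    (hd : x.d = x.e) (hps : x.p = x.s) (hp : x.p ^ 2 = heronPoly K x.b x.c x.e) :
    IsHeronianDiamond K x := by
  simp only [heronPoly] at hp
  constructor <;> simp only [heronPoly, ha, hq, hr, hb, hd, hps] at hp ⊢
  · linear_combination hp
  · ring
  · ring
  · linear_combination hp
  · ring
  · linear_combination -hp
  · ring

theorem neg (h : IsHeronianDiamond K x) :
    IsHeronianDiamond K { x with p := -x.p, q := -x.q, r := -x.r, s := -x.s } where
  heron_p := (neg_sq _).trans h.heron_p
  heron_q := (neg_sq _).trans h.heron_q
  heron_r := (neg_sq _).trans h.heron_r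
  heron_s := (neg_sq _).trans h.heron_s
  add_eq := by linear_combination -h.add_eq
  bretschneider := by linear_combination h.bretschneider
  sub_eq := by linear_combination -h.sub_eq

end IsHeronianDiamond

/-! ### Arrays as functions on the plane -/

section Values

variable {n : ℕ}

/-- The entry at `(i, j)`, or `0` outside the strip. -/
def nodeValue (w : CMIndex n → ℂ) (i j : ℤ) : ℂ :=
  if h : 0 ≤ j - i ∧ j - i ≤ n then w (.node i j h) else 0

/-- The entry at `(i + 1/2, j)`, or `0` outside the strip. -/
def fstValue (z : HeronianIndex n → ℂ) (i j : ℤ) : ℂ :=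
  if h : 1 ≤ j - i ∧ j - i ≤ n then z (.halfFst i j h) else 0

/-- The entry at `(i, j + 1/2)`, or `0` outside the strip. -/
def sndValue (z : HeronianIndex n → ℂ) (i j : ℤ) : ℂ :=
  if h : 0 ≤ j - i ∧ j - i ≤ n - 1 then z (.halfSnd i j h) else 0

/-- The six entries around the square with left corner `(i, j)`. -/
def sixAt (w : CMIndex n → ℂ) (i j : ℤ) : SixTuple where
  a := nodeValue w i (j + 1)
  b := w (.lineNE i)
  c := nodeValue w (i + 1) j
  d := w (.lineSE j)
  e := nodeValue w i j
  f := nodeValue w (i + 1) (j + 1)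

/-- The ten numbers around the square with left corner `(i, j)`, the half-integer entries being
given by the functions `X` and `Y`. -/
def tenAt (w : CMIndex n → ℂ) (X Y : ℤ → ℤ → ℂ) (i j : ℤ) : TenTuple where
  toSixTuple := sixAt w i j
  p := X i j
  q := Y i j
  r := X i (j + 1)
  s := Y (i + 1) j

theorem nodeValue_eq (w : CMIndex n → ℂ) {i j : ℤ} (h : 0 ≤ j - i ∧ j - i ≤ n) :
    nodeValue w i j = w (.node i j h) := dif_pos h

theorem fstValue_eq (z : HeronianIndex n → ℂ) {i j : ℤ} (h : 1 ≤ j - i ∧ j - i ≤ n) :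
    fstValue z i j = z (.halfFst i j h) := dif_pos h

theorem sndValue_eq (z : HeronianIndex n → ℂ) {i j : ℤ} (h : 0 ≤ j - i ∧ j - i ≤ n - 1) :
    sndValue z i j = z (.halfSnd i j h) := dif_pos h

theorem cmDiamond_eq (w : CMIndex n → ℂ) {i j : ℤ} (h : 1 ≤ j - i ∧ j - i ≤ n - 1) :
    cmDiamond w i j h = sixAt w i j := by
  simp only [cmDiamond, sixAt]
  rw [nodeValue_eq w (i := i) (j := j + 1) (by omega),
    nodeValue_eq w (i := i + 1) (j := j) (by omega), nodeValue_eq w (i := i) (j := j) (by omega),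
    nodeValue_eq w (i := i + 1) (j := j + 1) (by omega)]

theorem heronianDiamond_eq (z : HeronianIndex n → ℂ) {i j : ℤ} (h : 1 ≤ j - i ∧ j - i ≤ n - 1) :
    heronianDiamond z i j h = tenAt (restrict z) (fstValue z) (sndValue z) i j := by
  simp only [tenAt, ← cmDiamond_eq (restrict z) h]
  rw [fstValue_eq z (i := i) (j := j) (by omega), fstValue_eq z (i := i) (j := j + 1) (by omega),
    sndValue_eq z (i := i) (j := j) (by omega), sndValue_eq z (i := i + 1) (j := j) (by omega)]
  rfl

theorem InteriorNonvanishing.nodeValue_ne {K : ℂ} {w : CMIndex n → ℂ}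
    (h : InteriorNonvanishing K w) {i j : ℤ} (h1 : 2 ≤ j - i) (h2 : j - i ≤ n - 2) :
    nodeValue w i j ≠ 0 ∧ K * nodeValue w i j ≠ 4 := by
  rw [nodeValue_eq w (i := i) (j := j) (by omega)]
  exact h i j ⟨h1, h2⟩

theorem isCoherent_iff (K : ℂ) (w : CMIndex n → ℂ) :
    IsCoherent K w ↔ ∀ i j : ℤ, 2 ≤ j - i → j - i ≤ n - 2 →
      halfPartialLeft K (sixAt w i j) * halfPartialRight K (sixAt w (i + 1) (j + 1)) =
        halfPartialTop K (sixAt w i (j + 1)) * halfPartialBottom K (sixAt w (i + 1) j) := by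
  simp only [IsCoherent, cmDiamond_eq, partialLeft_eq, partialRight_eq, partialTop_eq,
    partialBottom_eq]
  constructor
  · intro h i j h1 h2
    have := h (i + 1) (j + 1) (by omega)
    simp only [add_sub_cancel_right] at this
    linear_combination this / 4
  · intro h i j hij
    have := h (i - 1) (j - 1) (by omega) (by omega)
    simp only [sub_add_cancel] at this
    linear_combination 4 * this

end Values

/-! ### From Heronian friezes to Cayley-Menger friezes -/

/-- The square of the entry at `(i + 1/2, j)` of a Heronian frieze that extends `w`. -/
def heronFst (K : ℂ) {n : ℕ} (w : CMIndex n → ℂ) (i j : ℤ) : ℂ :=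
  heronPoly K (nodeValue w i j) (nodeValue w (i + 1) j) (w (.lineNE i))

/-- The square of the entry at `(i, j + 1/2)` of a Heronian frieze that extends `w`. -/
def heronSnd (K : ℂ) {n : ℕ} (w : CMIndex n → ℂ) (i j : ℤ) : ℂ :=
  heronPoly K (nodeValue w i j) (nodeValue w i (j + 1)) (w (.lineSE j))

/-- The half-integer entries `X` and `Y` satisfy the relations that a Heronian frieze extending `w`
imposes on them. -/
abbrev IsSideSystemOf (K : ℂ) {n : ℕ} (w : CMIndex n → ℂ) (X Y : ℤ → ℤ → ℂ) : Prop :=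
  IsSideSystem n (heronFst K w) (heronSnd K w) (fun i j => halfPartialTop K (sixAt w i j))
    (fun i j => halfPartialBottom K (sixAt w i j)) (fun i j => halfPartialRight K (sixAt w i j)) X Y

namespace IsHeronianFrieze

variable {K : ℂ} {n : ℕ} {z : HeronianIndex n → ℂ}

theorem isHeronianDiamond_tenAt (h : IsHeronianFrieze K z) {i j : ℤ} (h1 : 1 ≤ j - i)
    (h2 : j - i ≤ n - 1) :
    IsHeronianDiamond K (tenAt (restrict z) (fstValue z) (sndValue z) i j) := by
  rw [← heronianDiamond_eq z ⟨h1, h2⟩]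
  exact h.diamond i j ⟨h1, h2⟩

theorem nodeValue_eq_zero (h : IsHeronianFrieze K z) {i j : ℤ} (hij : j - i = 0 ∨ j - i = n) :
    nodeValue (restrict z) i j = 0 := by
  rw [nodeValue_eq (restrict z) (i := i) (j := j) (by omega)]
  exact hij.elim (h.bottom i j) (h.top i j)

theorem fstValue_eq_zero (h : IsHeronianFrieze K z) (hn : 1 ≤ n) {i j : ℤ}
    (hij : j - i = 1 ∨ j - i = n) : fstValue z i j = 0 := by
  rw [fstValue_eq z (i := i) (j := j) (by omega)]
  exact hij.elim (fun h' => h.bottom_halfFst i j h' hn) fun h' => h.top_halfFst i j h' hn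

theorem sndValue_eq_zero (h : IsHeronianFrieze K z) (hn : 1 ≤ n) {i j : ℤ}
    (hij : j - i = 0 ∨ j - i = n - 1) : sndValue z i j = 0 := by
  rw [sndValue_eq z (i := i) (j := j) (by omega)]
  exact hij.elim (fun h' => h.bottom_halfSnd i j h' hn) fun h' => h.top_halfSnd i j h' hn

theorem bottomRow (h : IsHeronianFrieze K z) (hn : 4 ≤ n) {i j : ℤ} (hij : j - i = 1) :
    restrict z (.lineNE i) = nodeValue (restrict z) i j ∧
      restrict z (.lineSE j) = nodeValue (restrict z) (i + 1) (j + 1) ∧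
      sndValue z i j = fstValue z i (j + 1) :=
  (h.isHeronianDiamond_tenAt (by omega) (by omega)).eq_of_bottom_eq_zero
    (h.nodeValue_eq_zero (i := i + 1) (j := j) (by omega))
    (h.fstValue_eq_zero (i := i) (j := j) (by omega) (by omega))
    (h.sndValue_eq_zero (i := i + 1) (j := j) (by omega) (by omega))

theorem topRow (h : IsHeronianFrieze K z) (hn : 4 ≤ n) {i j : ℤ} (hij : j - i = n - 1) :
    restrict z (.lineNE i) = nodeValue (restrict z) (i + 1) (j + 1) ∧
      restrict z (.lineSE j) = nodeValue (restrict z) i j ∧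
      fstValue z i j = sndValue z (i + 1) j :=
  (h.isHeronianDiamond_tenAt (by omega) (by omega)).eq_of_top_eq_zero
    (h.nodeValue_eq_zero (i := i) (j := j + 1) (by omega))
    (h.sndValue_eq_zero (i := i) (j := j) (by omega) (by omega))
    (h.fstValue_eq_zero (i := i) (j := j + 1) (by omega) (by omega))

theorem hasMinorProducts (h : IsHeronianFrieze K z) (hz : InteriorNonvanishing K (restrict z))
    {i j : ℤ} (h1 : 2 ≤ j - i) (h2 : j - i ≤ n - 2) :
    HasMinorProducts K (tenAt (restrict z) (fstValue z) (sndValue z) i j) :=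
  (h.isHeronianDiamond_tenAt (by omega) (by omega)).hasMinorProducts (hz.nodeValue_ne h1 h2).1
    (hz.nodeValue_ne h1 h2).2

theorem isSideSystem (h : IsHeronianFrieze K z) (hn : 4 ≤ n)
    (hz : InteriorNonvanishing K (restrict z)) :
    IsSideSystemOf K (restrict z) (fstValue z) (sndValue z) where
  fst_sq i j h1 h2 := by
    refine (h.isHeronianDiamond_tenAt (by omega) h2).heron_p.trans ?_
    simp only [tenAt, sixAt, heronFst, heronPoly]; ring
  snd_sq i j h1 h2 := by
    refine (h.isHeronianDiamond_tenAt h1 (by omega)).heron_q.trans ?_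
    simp only [tenAt, sixAt, heronSnd, heronPoly]; ring
  right i j h1 h2 := (h.isHeronianDiamond_tenAt (by omega) (by omega)).mul_eq_right
  bottom i j h1 h2 := by
    rcases h1.lt_or_eq with h1' | h1'
    · exact (h.hasMinorProducts hz (by omega) h2).bottom
    · obtain ⟨hb, hd, hqr⟩ := h.bottomRow hn h1'.symm
      rw [← hqr, ← sq, halfPartialBottom_of_bottom_eq_zero
        (h.nodeValue_eq_zero (i := i + 1) (j := j) (by omega)) hb hd]
      exact (h.isHeronianDiamond_tenAt h1 (by omega)).heron_q
  top i j h1 h2 := by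
    rcases h2.lt_or_eq with h2' | h2'
    · exact (h.hasMinorProducts hz h1 (by omega)).top
    · obtain ⟨hb, hd, hps⟩ := h.topRow hn h2'
      rw [← hps, ← sq, halfPartialTop_of_top_eq_zero
        (h.nodeValue_eq_zero (i := i) (j := j + 1) (by omega)) hb hd]
      exact (h.isHeronianDiamond_tenAt (by omega) h2).heron_p

theorem isCMFrieze_restrict (h : IsHeronianFrieze K z) (hn : 4 ≤ n)
    (hz : InteriorNonvanishing K (restrict z)) : IsCMFrieze K (restrict z) where
  diamond i j hij := by
    rw [IsCayleyMengerDiamond, cmDiamond_eq]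
    rcases hij.1.lt_or_eq with h1 | h1
    · rcases hij.2.lt_or_eq with h2 | h2
      · have he := hz.nodeValue_ne (i := i) (j := j) (by omega) (by omega)
        exact (h.isHeronianDiamond_tenAt hij.1 hij.2).cayleyMenger_eq_zero he.1 he.2
      · obtain ⟨hb, hd, -⟩ := h.topRow hn h2
        exact cayleyMenger_of_top_eq_zero
          (h.nodeValue_eq_zero (i := i) (j := j + 1) (by omega)) hb hd
    · obtain ⟨hb, hd, -⟩ := h.bottomRow hn h1.symm
      exact cayleyMenger_of_bottom_eq_zero
        (h.nodeValue_eq_zero (i := i + 1) (j := j) (by omega)) hb hd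
  bottom := h.bottom
  top := h.top
  bottom_lineNE i j hij _ := by
    rw [← nodeValue_eq (restrict z) (by omega), (h.bottomRow hn hij).1]
  bottom_lineSE i j hij _ := by
    have := (h.bottomRow hn (i := i - 1) (j := j - 1) (by omega)).2.1
    simp only [sub_add_cancel] at this
    rw [← nodeValue_eq (restrict z) (by omega), ← this, show j - 1 = i by omega]
  top_lineNE i j hij _ := by
    have := (h.topRow hn (i := i - 1) (j := j - 1) (by omega)).1
    simp only [sub_add_cancel] at this
    rw [← nodeValue_eq (restrict z) (by omega), ← this]
  top_lineSE i j hij _ := by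
    rw [← nodeValue_eq (restrict z) (by omega), (h.topRow hn hij).2.1]

/-- Both sides of the coherence relation are the product of the four half-integer entries next to
the node. -/
theorem isCoherent_restrict (h : IsHeronianFrieze K z) (hn : 4 ≤ n)
    (hz : InteriorNonvanishing K (restrict z)) : IsCoherent K (restrict z) := by
  rw [isCoherent_iff]
  intro i j h1 h2
  have hs := h.isSideSystem hn hz
  have hl : fstValue z i (j + 1) * sndValue z (i + 1) j =
      -halfPartialLeft K (sixAt (restrict z) i j) :=
    (h.hasMinorProducts hz h1 h2).left
  have hr := hs.right (i + 1) (j + 1) (by omega) (by omega)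
  have ht := hs.top i (j + 1) (by omega) (by omega)
  have hb := hs.bottom (i + 1) j (by omega) (by omega)
  rw [← ht, ← hb]
  linear_combination halfPartialRight K (sixAt (restrict z) (i + 1) (j + 1)) * hl
    - fstValue z i (j + 1) * sndValue z (i + 1) j * hr

end IsHeronianFrieze

/-! ### From Cayley-Menger friezes to Heronian friezes -/

namespace IsCMFrieze

variable {K : ℂ} {n : ℕ} {w : CMIndex n → ℂ}

theorem cayleyMenger_sixAt (h : IsCMFrieze K w) {i j : ℤ} (h1 : 1 ≤ j - i)
    (h2 : j - i ≤ n - 1) : cayleyMenger K (sixAt w i j) = 0 := by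
  rw [← cmDiamond_eq w ⟨h1, h2⟩]
  exact h.diamond i j ⟨h1, h2⟩

theorem nodeValue_eq_zero (h : IsCMFrieze K w) {i j : ℤ} (hij : j - i = 0 ∨ j - i = n) :
    nodeValue w i j = 0 := by
  rw [nodeValue_eq w (i := i) (j := j) (by omega)]
  exact hij.elim (h.bottom i j) (h.top i j)

theorem bottomRow (h : IsCMFrieze K w) (hn : 4 ≤ n) {i j : ℤ} (hij : j - i = 1) :
    w (.lineNE i) = nodeValue w i j ∧ w (.lineSE j) = nodeValue w (i + 1) (j + 1) := by
  rw [nodeValue_eq w (i := i) (j := j) (by omega),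
    nodeValue_eq w (i := i + 1) (j := j + 1) (by omega), h.bottom_lineNE i j hij (by omega),
    h.bottom_lineSE (i + 1) (j + 1) (by omega) (by omega), show i + 1 = j by omega]
  exact ⟨rfl, rfl⟩

theorem topRow (h : IsCMFrieze K w) (hn : 4 ≤ n) {i j : ℤ} (hij : j - i = n - 1) :
    w (.lineNE i) = nodeValue w (i + 1) (j + 1) ∧ w (.lineSE j) = nodeValue w i j := by
  rw [nodeValue_eq w (i := i) (j := j) (by omega),
    nodeValue_eq w (i := i + 1) (j := j + 1) (by omega), h.top_lineSE i j hij (by omega),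
    h.top_lineNE (i + 1) (j + 1) (by omega) (by omega), add_sub_cancel_right]
  exact ⟨rfl, rfl⟩

theorem isSideData (h : IsCMFrieze K w) (hn : 4 ≤ n) (hc : IsCoherent K w)
    (hw : HeronNonvanishing K w) :
    IsSideData n (heronFst K w) (heronSnd K w) (fun i j => halfPartialTop K (sixAt w i j))
      (fun i j => halfPartialBottom K (sixAt w i j)) (fun i j => halfPartialLeft K (sixAt w i j))
      (fun i j => halfPartialRight K (sixAt w i j)) where
  fst_ne_zero i j h1 h2 := by
    rw [heronFst, nodeValue_eq w (i := i) (j := j) (by omega),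
      nodeValue_eq w (i := i + 1) (j := j) (by omega)]
    exact (hw i j ⟨h1, h2⟩).1
  snd_ne_zero i j h1 h2 := by
    rw [heronSnd, nodeValue_eq w (i := i) (j := j) (by omega),
      nodeValue_eq w (i := i) (j := j + 1) (by omega)]
    have := (hw i (j + 1) (by omega)).2
    simpa only [add_sub_cancel_right] using this
  start_fst i := by
    obtain ⟨hb, hd⟩ := h.bottomRow hn (i := i) (j := i + 1) (by omega)
    refine (halfPartialBottom_of_bottom_eq_zero
      (h.nodeValue_eq_zero (i := i + 1) (j := i + 1) (by omega)) hb hd).trans ?_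
    simp only [sixAt, heronFst, hb, hd, show i + 2 = i + 1 + 1 by ring, heronPoly]
  start_snd i := by
    obtain ⟨hb, hd⟩ := h.bottomRow hn (i := i) (j := i + 1) (by omega)
    refine (halfPartialBottom_of_bottom_eq_zero
      (h.nodeValue_eq_zero (i := i + 1) (j := i + 1) (by omega)) hb hd).trans ?_
    simp only [sixAt, heronSnd, heronPoly]
    ring
  right_sq i j h1 h2 := by
    rw [halfPartialRight_sq, h.cayleyMenger_sixAt (by omega) (by omega)]
    simp only [sixAt, heronFst, heronSnd, heronPoly]
    ring
  bottom_sq i j h1 h2 := by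
    rw [halfPartialBottom_sq, h.cayleyMenger_sixAt (by omega) (by omega)]
    simp only [sixAt, heronFst, heronSnd, heronPoly]
    ring
  top_sq i j h1 h2 := by
    rw [halfPartialTop_sq, h.cayleyMenger_sixAt (by omega) (by omega)]
    simp only [sixAt, heronFst, heronSnd, heronPoly]
    ring
  left_mul_right i j h1 h2 := by
    rw [halfPartialLeft_mul_halfPartialRight, h.cayleyMenger_sixAt (by omega) (by omega), zero_mul,
      add_zero]
  coherent := (isCoherent_iff K w).1 hc

end IsCMFrieze

/-- The array that extends `w` by the half-integer entries `X` and `Y` in the interior of the strip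
and by zeros next to its boundary. -/
def extend {n : ℕ} (w : CMIndex n → ℂ) (X Y : ℤ → ℤ → ℂ) : HeronianIndex n → ℂ
  | .node i j h => w (.node i j h)
  | .halfFst i j _ => if 2 ≤ j - i ∧ j - i ≤ n - 1 then X i j else 0
  | .halfSnd i j _ => if 1 ≤ j - i ∧ j - i ≤ n - 2 then Y i j else 0
  | .lineNE i => w (.lineNE i)
  | .lineSE j => w (.lineSE j)

section Extend

variable {K : ℂ} {n : ℕ} {w : CMIndex n → ℂ} {X Y : ℤ → ℤ → ℂ}

theorem restrict_extend (w : CMIndex n → ℂ) (X Y : ℤ → ℤ → ℂ) : restrict (extend w X Y) = w := by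
  funext α
  cases α <;> rfl

theorem restrict_signChange (z : HeronianIndex n → ℂ) : restrict (signChange z) = restrict z := by
  funext α
  cases α <;> rfl

theorem fstValue_extend {i j : ℤ} (h1 : 2 ≤ j - i) (h2 : j - i ≤ n - 1) :
    fstValue (extend w X Y) i j = X i j := by
  rw [fstValue_eq _ (by omega)]
  exact if_pos ⟨h1, h2⟩

theorem fstValue_extend_eq_zero {i j : ℤ} (hij : j - i = 1 ∨ j - i = n) :
    fstValue (extend w X Y) i j = 0 := by
  rw [fstValue]
  split_ifs
  · exact if_neg (by omega)
  · rfl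

theorem sndValue_extend {i j : ℤ} (h1 : 1 ≤ j - i) (h2 : j - i ≤ n - 2) :
    sndValue (extend w X Y) i j = Y i j := by
  rw [sndValue_eq _ (by omega)]
  exact if_pos ⟨h1, h2⟩

theorem sndValue_extend_eq_zero {i j : ℤ} (hij : j - i = 0 ∨ j - i = n - 1) :
    sndValue (extend w X Y) i j = 0 := by
  rw [sndValue]
  split_ifs
  · exact if_neg (by omega)
  · rfl

theorem isHeronianFrieze_extend (hn : 4 ≤ n) (h : IsCMFrieze K w) (hc : IsCoherent K w)
    (hw : HeronNonvanishing K w) (hs : IsSideSystemOf K w X Y) :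
    IsHeronianFrieze K (extend w X Y) where
  diamond i j hij := by
    have hd := h.isSideData hn hc hw
    rw [heronianDiamond_eq, restrict_extend]
    rcases hij.1.lt_or_eq with h1 | h1
    · have hp := fstValue_extend (w := w) (X := X) (Y := Y) (i := i) (j := j) (by omega) (by omega)
      have hs' := sndValue_extend (w := w) (X := X) (Y := Y) (i := i + 1) (j := j) (by omega)
        (by omega)
      have hpsq : X i j ^ 2 = heronPoly K (w (.lineNE i)) (nodeValue w (i + 1) j)
          (nodeValue w i j) := by
        rw [hs.fst_sq i j (by omega) (by omega)]
        simp only [heronFst, heronPoly]; ring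
      rcases hij.2.lt_or_eq with h2 | h2
      · have hq := sndValue_extend (w := w) (X := X) (Y := Y) (i := i) (j := j) (by omega)
          (by omega)
        have hr := fstValue_extend (w := w) (X := X) (Y := Y) (i := i) (j := j + 1) (by omega)
          (by omega)
        apply isHeronianDiamond_of_mul_eq <;> simp only [tenAt, hp, hq, hr, hs']
        · exact h.cayleyMenger_sixAt hij.1 hij.2
        · exact hpsq
        · rw [hs.snd_sq i j (by omega) (by omega)]
          simp only [sixAt, heronSnd, heronPoly]; ring
        · rw [hs.fst_sq i (j + 1) (by omega) (by omega)]
          simp only [sixAt, heronFst, heronPoly]; ring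
        · rw [hs.snd_sq (i + 1) j (by omega) (by omega)]
          simp only [sixAt, heronSnd, heronPoly]; ring
        · exact hs.fst_ne_zero hd i j (by omega) (by omega)
        · exact hs.snd_ne_zero hd i j (by omega) (by omega)
        · exact hs.top i j (by omega) (by omega)
        · exact hs.bottom i j (by omega) (by omega)
        · exact hs.right i j (by omega) (by omega)
      · obtain ⟨hb, hd'⟩ := h.topRow hn h2
        have ha := h.nodeValue_eq_zero (i := i) (j := j + 1) (by omega)
        apply IsHeronianDiamond.of_top_eq_zero ha
          (sndValue_extend_eq_zero (i := i) (j := j) (by omega))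
          (fstValue_extend_eq_zero (i := i) (j := j + 1) (by omega)) hb hd'
        · -- The prescribed product `ps` equals `p²`, and `p` does not vanish.
          have ht := hs.top i j (by omega) (by omega)
          rw [halfPartialTop_of_top_eq_zero (x := sixAt w i j) ha hb hd'] at ht
          simp only [tenAt, hp, hs']
          apply mul_left_cancel₀ (hs.fst_ne_zero hd i j (by omega) (by omega))
          rw [ht, ← sq, hpsq]
          rfl
        · simp only [tenAt, hp]
          exact hpsq
    · obtain ⟨hb, hd'⟩ := h.bottomRow hn h1.symm
      have hc' := h.nodeValue_eq_zero (i := i + 1) (j := j) (by omega)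
      have hq := sndValue_extend (w := w) (X := X) (Y := Y) (i := i) (j := j) (by omega)
        (by omega)
      have hr := fstValue_extend (w := w) (X := X) (Y := Y) (i := i) (j := j + 1) (by omega)
        (by omega)
      apply IsHeronianDiamond.of_bottom_eq_zero hc'
        (fstValue_extend_eq_zero (i := i) (j := j) (by omega))
        (sndValue_extend_eq_zero (i := i + 1) (j := j) (by omega)) hb hd'
      · -- The prescribed product `qr` equals `q²`, and `q` does not vanish.
        have ht := hs.bottom i j (by omega) (by omega)
        rw [halfPartialBottom_of_bottom_eq_zero (x := sixAt w i j) hc' hb hd'] at ht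
        simp only [tenAt, hq, hr]
        apply mul_left_cancel₀ (hs.snd_ne_zero hd i j (by omega) (by omega))
        rw [ht, ← sq, hs.snd_sq i j (by omega) (by omega)]
        simp only [sixAt, heronSnd, heronPoly]; ring
      · simp only [tenAt, hr]
        rw [hs.fst_sq i (j + 1) (by omega) (by omega)]
        simp only [sixAt, heronFst, heronPoly]; ring
  bottom := h.bottom
  top := h.top
  bottom_halfFst i j hij _ := if_neg (by omega)
  bottom_halfSnd i j hij _ := if_neg (by omega)
  top_halfFst i j hij _ := if_neg (by omega)
  top_halfSnd i j hij _ := if_neg (by omega)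

end Extend

theorem IsHeronianFrieze.signChange {K : ℂ} {n : ℕ} {z : HeronianIndex n → ℂ}
    (h : IsHeronianFrieze K z) : IsHeronianFrieze K (signChange z) where
  diamond i j hij := (h.diamond i j hij).neg
  bottom := h.bottom
  top := h.top
  bottom_halfFst i j hij hn := neg_eq_zero.2 (h.bottom_halfFst i j hij hn)
  bottom_halfSnd i j hij hn := neg_eq_zero.2 (h.bottom_halfSnd i j hij hn)
  top_halfFst i j hij hn := neg_eq_zero.2 (h.top_halfFst i j hij hn)
  top_halfSnd i j hij hn := neg_eq_zero.2 (h.top_halfSnd i j hij hn)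

/-- Two Heronian friezes with the same restriction agree up to a global sign of their half-integer
entries. -/
theorem IsHeronianFrieze.eq_or_eq_signChange {K : ℂ} {n : ℕ} (hn : 4 ≤ n)
    {z z' : HeronianIndex n → ℂ} (h : IsHeronianFrieze K z) (h' : IsHeronianFrieze K z')
    (hzz : restrict z' = restrict z) (hz : InteriorNonvanishing K (restrict z))
    (hw : HeronNonvanishing K (restrict z)) : z' = z ∨ z' = SphericalFrieze.signChange z := by
  have hd := (h.isCMFrieze_restrict hn hz).isSideData hn (h.isCoherent_restrict hn hz) hw
  have hs := h.isSideSystem hn hz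
  have hs' := h'.isSideSystem hn (hzz ▸ hz)
  rw [hzz] at hs'
  obtain ⟨ε, hε, hX, hY⟩ := hs.eq_or_eq_neg hn hd hs'
  have hfst : ∀ i j hij, z' (.halfFst i j hij) = ε * z (.halfFst i j hij) := by
    intro i j hij
    rw [← fstValue_eq z', ← fstValue_eq z]
    by_cases hb : j - i = 1 ∨ j - i = n
    · rw [h.fstValue_eq_zero (by omega) hb, h'.fstValue_eq_zero (by omega) hb, mul_zero]
    · exact hX i j (by omega) (by omega)
  have hsnd : ∀ i j hij, z' (.halfSnd i j hij) = ε * z (.halfSnd i j hij) := by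
    intro i j hij
    rw [← sndValue_eq z', ← sndValue_eq z]
    by_cases hb : j - i = 0 ∨ j - i = n - 1
    · rw [h.sndValue_eq_zero (by omega) hb, h'.sndValue_eq_zero (by omega) hb, mul_zero]
    · exact hY i j (by omega) (by omega)
  refine hε.imp ?_ ?_ <;> rintro rfl <;> funext α <;> cases α with
  | node i j hij => exact congrFun hzz (.node i j hij)
  | halfFst i j hij => simp [hfst, SphericalFrieze.signChange]
  | halfSnd i j hij => simp [hsnd, SphericalFrieze.signChange]
  | lineNE i => exact congrFun hzz (.lineNE i)
  | lineSE j => exact congrFun hzz (.lineSE j)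

end SphericalFrieze

end

theorem mainTheorem3 (K : ℂ) (n : ℕ) (hn : 4 ≤ n) :
    (∀ z : SphericalFrieze.HeronianIndex n → ℂ,
      SphericalFrieze.IsHeronianFrieze K z →
      SphericalFrieze.InteriorNonvanishing K (SphericalFrieze.restrict z) →
        SphericalFrieze.IsCMFrieze K (SphericalFrieze.restrict z) ∧
        SphericalFrieze.IsCoherent K (SphericalFrieze.restrict z)) ∧
    (∀ w : SphericalFrieze.CMIndex n → ℂ,
      SphericalFrieze.IsCMFrieze K w →
      SphericalFrieze.IsCoherent K w →
      SphericalFrieze.InteriorNonvanishing K w →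
      SphericalFrieze.HeronNonvanishing K w →
        ∃ z : SphericalFrieze.HeronianIndex n → ℂ,
          (SphericalFrieze.IsHeronianFrieze K z ∧ SphericalFrieze.restrict z = w) ∧
          ∀ z' : SphericalFrieze.HeronianIndex n → ℂ,
            (SphericalFrieze.IsHeronianFrieze K z' ∧ SphericalFrieze.restrict z' = w) ↔
              (z' = z ∨ z' = SphericalFrieze.signChange z)) := by
  refine ⟨fun z h hz => ⟨h.isCMFrieze_restrict hn hz, h.isCoherent_restrict hn hz⟩, ?_⟩
  intro w h hc hw hH
  obtain ⟨X, Y, hs⟩ := (h.isSideData hn hc hH).exists_isSideSystem hn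
  have hz := SphericalFrieze.isHeronianFrieze_extend hn h hc hH hs
  have hr := SphericalFrieze.restrict_extend w X Y
  refine ⟨_, ⟨hz, hr⟩, fun z' => ⟨fun h' => ?_, ?_⟩⟩
  · exact hz.eq_or_eq_signChange hn h'.1 (h'.2.trans hr.symm) (hr.symm ▸ hw) (hr.symm ▸ hH)
  · rintro (rfl | rfl)
    · exact ⟨hz, hr⟩
    · exact ⟨hz.signChange, (SphericalFrieze.restrict_signChange _).trans hr⟩
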